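/- Let $d,m\in\mathbb N$, let $Y$ be a countable set of labels and let $\mathcal D$ be the law of a labelled example $(x,y)\in\mathbb R^d\times Y$ obtained by drawing $y$ with probability $\mathcal D_y$ and then $x\sim\mathcal N_y$, where under $\mathcal N_y$ the coordinates $x_1,\dots,x_d$ are independent with $x_i\sim\mathcal N(\mu_{y,i},\sigma_{y,i}^2)$, $\sigma_{y,i}\ge 0$. Let $p$ be a probability distribution of the parameter $w$, and let $\ell(w,x,y)\ge 0$ be a measurable loss that is smooth (it suffices: continuously differentiable) in $x$, with finite risk $L_D(w)=\mathbb E_{(x,y)\sim\mathcal D}\,\ell(w,x,y)$ for every $w$. For a sample $S=((x_1,y_1),\dots,(x_m,y_m))\sim\mathcal D^m$ put $L_S(w)=\frac1m\sum_{i=1}^m\ell(w,x_i,y_i)$, and for $\lambda>0$ let $$C(\lambda,p)=\log\Big(\mathbb E_{w\sim p,\;S\sim \mathcal D^m}\big[e^{\lambda(L_D(w)-L_S(w))}\big]\Big).$$ Let $0<\lambda\le m$ and assume that the loss per label is balanced: for every $w$ and every $\alpha\in(0,\lambda/m]$, the number $\mathbb E_{x\sim\mathcal N_y}[e^{-\alpha\ell(w,x,y)}]$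 is the same for all labels $y$. Then $$C(\lambda,p)\le \log\bigg(\mathbb E_{w\sim p}\bigg[\exp\bigg(\frac{\lambda^2\, e^{\mathbb E_{\mathcal D}\ell(w,x,y)}\;\mathbb E_{\mathcal D}\big[\|\sigma_y\cdot\nabla_x\ell(w,x,y)\|^2\big]}{2m}\bigg)\bigg]\bigg),$$ where $\sigma_y\cdot\nabla_x\ell$ is the element-wise product. Moreover, for every $\sigma\ge 0$ with $\sigma_{y,i}\le\sigma$ for all $y,i$ (in particular for the common value $\sigma$ if all $\sigma_{y,i}$ are equal), $$C(\lambda,p)\le \log\bigg(\mathbb E_{w\sim p}\bigg[\exp\bigg(\frac{\lambda^2\, e^{\mathbb E_{\mathcal D}\ell(w,x,y)}\;\mathbb E_{\mathcal D}\big[\|\nabla_x\ell(w,x,y)\|^2\big]\,\sigma^2}{2m}\bigg)\bigg]\bigg).$$ The expectations of squared gradient norms and of exponentials are taken in $[0,\infty]$ (with $0\cdot\infty=0$ and $\log\infty=\infty$); no bound on the loss or on its gradient that is uniform in $w$ is assumed. -/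

import Mathlib

open MeasureTheory ProbabilityTheory
open scoped NNReal ENNReal

noncomputable section

namespace PACBayes

/-- The data space `ℝᵈ` with its Euclidean norm. -/
abbrev Data (d : ℕ) : Type := EuclideanSpace ℝ (Fin d)

/-- The class-conditional law `𝒩_y`: the coordinates are independent and the `i`-th one has law
`𝒩(μ_{y,i}, σ_{y,i}²)`. -/
def classLaw {Y : Type*} {d : ℕ} (μ : Y → Fin d → ℝ) (σ : Y → Fin d → ℝ≥0) (y : Y) :
    Measure (Data d) :=
  (Measure.pi fun i => gaussianReal (μ y i) (σ y i ^ 2)).map (WithLp.toLp 2)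

/-- The law `𝒟 = ∑_y 𝒟_y · 𝒩_y` of a labelled example `(x, y)`: the label has law `π`, and given
the label `y` the datum `x` has law `𝒩_y`. -/
def dataLaw {Y : Type*} [MeasurableSpace Y] {d : ℕ} (π : PMF Y) (μ : Y → Fin d → ℝ)
    (σ : Y → Fin d → ℝ≥0) : Measure (Data d × Y) :=
  Measure.sum fun y => π y • (classLaw μ σ y).prod (Measure.dirac y)

/-- The risk `L_D(w) = 𝔼_{(x,y) ∼ D} ℓ(w,x,y)`. -/
def risk {W X Y : Type*} [MeasurableSpace X] [MeasurableSpace Y] (D : Measure (X × Y))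
    (ℓ : W → X → Y → ℝ) (w : W) : ℝ :=
  ∫ z, ℓ w z.1 z.2 ∂D

/-- The empirical risk `L_S(w) = (1/m) ∑_i ℓ(w,x_i,y_i)`. -/
def empiricalRisk {W X Y : Type*} {m : ℕ} (ℓ : W → X → Y → ℝ) (S : Fin m → X × Y) (w : W) : ℝ :=
  (1 / (m : ℝ)) * ∑ i, ℓ w (S i).1 (S i).2

/-- The complexity term `C(λ,p) = log 𝔼_{w ∼ p, S ∼ D^m} exp (λ (L_D(w) - L_S(w)))`, with values in
the extended reals (it is `⊤` when the expectation is infinite). -/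
def complexityTerm {W X Y : Type*} [MeasurableSpace W] [MeasurableSpace X] [MeasurableSpace Y]
    (D : Measure (X × Y)) (ℓ : W → X → Y → ℝ) (m : ℕ) (lam : ℝ) (p : Measure W) : EReal :=
  ENNReal.log (∫⁻ z, ENNReal.ofReal
    (Real.exp (lam * (risk D ℓ z.1 - empiricalRisk ℓ z.2 z.1)))
      ∂(p.prod (Measure.pi fun _ : Fin m => D)))

/-- `𝔼_{(x,y) ∼ D} ‖∇_x ℓ(w,x,y)‖²`, with values in `[0,∞]`. -/
def gradientEnergy {W Y : Type*} [MeasurableSpace Y] {d : ℕ} (D : Measure (Data d × Y))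
    (ℓ : W → Data d → Y → ℝ) (w : W) : ℝ≥0∞ :=
  ∫⁻ z, ENNReal.ofReal (‖gradient (fun x => ℓ w x z.2) z.1‖ ^ 2) ∂D

/-- `𝔼_{(x,y) ∼ D} ‖σ_y · ∇_x ℓ(w,x,y)‖²`, with the element-wise product of `σ_y` and the gradient;
values in `[0,∞]`. -/
def weightedGradientEnergy {W Y : Type*} [MeasurableSpace Y] {d : ℕ} (D : Measure (Data d × Y))
    (σ : Y → Fin d → ℝ≥0) (ℓ : W → Data d → Y → ℝ) (w : W) : ℝ≥0∞ :=
  ∫⁻ z, ENNReal.ofReal (‖(WithLp.toLp 2 fun i =>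
    (σ z.2 i : ℝ) * gradient (fun x => ℓ w x z.2) z.1 i : Data d)‖ ^ 2) ∂D

/-- The loss per label is balanced for the exponents `α ∈ (0, a]`: for every `w` the expectation
`𝔼_{x ∼ 𝒩_y} exp (-α ℓ(w,x,y))` is the same for all labels `y`. -/
def IsLabelBalanced {W Y : Type*} {d : ℕ} (μ : Y → Fin d → ℝ) (σ : Y → Fin d → ℝ≥0)
    (ℓ : W → Data d → Y → ℝ) (a : ℝ) : Prop :=
  ∀ w, ∀ α ∈ Set.Ioc 0 a, ∃ c : ℝ, ∀ y,
    ∫ x, Real.exp (-α * ℓ w x y) ∂(classLaw μ σ y) = c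

end PACBayes

end

/-! Fix `w`, write `L` for the risk and put `a = lam / m ≤ 1`. As the loss is nonnegative, `v = a *
(L - ℓ)` never exceeds `L`, so `exp v ≤ 1 + v + exp L / 2 * v ^ 2`
(`exp_le_one_add_add_sq_mul_exp`). The linear term has mean zero, hence one example contributes at
most `exp (a ^ 2 * exp L / 2 * Var ℓ)`. By independence the `m` factors multiply, and `m * (lam / m)
^ 2 = lam ^ 2 / m`.

It remains to bound the variance by the gradient energy. Balance makes the Laplace transforms of the
loss agree across labels for small exponents, hence also their derivatives at zero, the class means
(`integral_classLaw_eq_risk`). So there is no between-class variance, and the Gaussian Poincaré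
inequality applies inside each class (`evariance_classLaw_le`). The latter comes from a
one-dimensional inequality, Efron–Stein (`evariance_pi_le`) and truncation. -/

/-! ### The one-dimensional Gaussian Poincaré inequality. -/

open Set in
theorem sq_sub_le_mul_integral_deriv_sq {f : ℝ → ℝ} (hf : ContDiff ℝ 1 f) {x : ℝ} (hx : 0 < x) :
    (f x - f 0) ^ 2 ≤ x * ∫ t in (0 : ℝ)..x, deriv f t ^ 2 := by
  have hc : Continuous (deriv f) := hf.continuous_deriv le_rfl
  have hint : ∫ t in (0 : ℝ)..x, deriv f t = f x - f 0 :=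
    intervalIntegral.integral_deriv_eq_sub
      (fun t _ => (hf.differentiable (by norm_num)).differentiableAt) (hc.intervalIntegrable _ _)
  -- With `c` the mean slope, nonnegativity of the integral of `(deriv f - c) ^ 2` is
  -- Cauchy–Schwarz.
  set c : ℝ := (f x - f 0) / x with hcdef
  have h0 : 0 ≤ ∫ t in (0 : ℝ)..x, (deriv f t ^ 2 - 2 * c * deriv f t + c ^ 2) := by
    refine intervalIntegral.integral_nonneg hx.le fun t _ => ?_
    nlinarith [sq_nonneg (deriv f t - c)]
  rw [intervalIntegral.integral_add, intervalIntegral.integral_sub,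
    intervalIntegral.integral_const_mul, hint, intervalIntegral.integral_const] at h0
  · have h1 : f x - f 0 = c * x := by rw [hcdef]; field_simp
    rw [h1] at h0 ⊢
    simp only [sub_zero, smul_eq_mul] at h0
    nlinarith
  all_goals exact Continuous.intervalIntegrable (by fun_prop) _ _

-- The standard Gaussian density `φ` satisfies `φ' x = -x * φ x`.
open Set in
theorem lintegral_Ici_gaussianPDF_mul_id {t : ℝ} (ht : 0 ≤ t) :
    ∫⁻ x in Ici t, gaussianPDF 0 1 x * ENNReal.ofReal x = gaussianPDF 0 1 t := by
  have hd : ∀ x ∈ Ici t, HasDerivAt (fun x => -gaussianPDFReal 0 1 x)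
      (gaussianPDFReal 0 1 x * x) x := by
    intro x _
    have h1 : HasDerivAt (fun x : ℝ => -(x - 0) ^ 2 / (2 * ((1 : ℝ≥0) : ℝ))) (-x) x := by
      have := (((hasDerivAt_id x).sub_const 0).pow 2).neg.div_const (2 * ((1 : ℝ≥0) : ℝ))
      refine this.congr_deriv ?_
      simp
      ring
    have h2 := ((h1.exp).const_mul (√(2 * Real.pi * (1 : ℝ≥0)))⁻¹).neg
    refine h2.congr_deriv ?_
    simp only [gaussianPDFReal]
    ring
  have hnn : ∀ x ∈ Ioi t, 0 ≤ gaussianPDFReal 0 1 x * x := fun x hx =>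
    mul_nonneg (gaussianPDFReal_nonneg _ _ _) (ht.trans (le_of_lt hx))
  have hlim : Filter.Tendsto (fun x => -gaussianPDFReal 0 1 x) Filter.atTop (nhds 0) := by
    rw [show (0 : ℝ) = -((√(2 * Real.pi * (1 : ℝ≥0)))⁻¹ * 0) by simp]
    refine (Filter.Tendsto.const_mul _ (Real.tendsto_exp_atBot.comp ?_)).neg
    have : Filter.Tendsto (fun x : ℝ => x ^ 2 / 2) Filter.atTop Filter.atTop :=
      (Filter.tendsto_pow_atTop two_ne_zero).atTop_div_const two_pos
    refine (Filter.tendsto_neg_atTop_atBot.comp this).congr fun x => ?_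
    simp [neg_div]
  have hI := integral_Ioi_of_hasDerivAt_of_nonneg' hd hnn hlim
  have hi := integrableOn_Ioi_deriv_of_nonneg' hd hnn hlim
  rw [setLIntegral_congr Ioi_ae_eq_Ici.symm, gaussianPDF]
  have := ofReal_integral_eq_lintegral_ofReal hi
    ((ae_restrict_iff' measurableSet_Ioi).2 (Filter.Eventually.of_forall hnn))
  rw [hI] at this
  simp only [zero_sub, neg_neg] at this
  rw [this]
  refine lintegral_congr fun x => ?_
  rw [gaussianPDF, ENNReal.ofReal_mul (gaussianPDFReal_nonneg _ _ _)]

-- Cauchy–Schwarz on `[0, x]` costs a factor `x`. After Tonelli this factor is integrated against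
-- the density over `x ≥ t`, which returns exactly the density at `t`; hence the constant 1.
open Set in
theorem setLIntegral_Ioi_gaussianPDF_mul_sq_sub_le {f : ℝ → ℝ} (hf : ContDiff ℝ 1 f) :
    ∫⁻ x in Ioi 0, gaussianPDF 0 1 x * ENNReal.ofReal ((f x - f 0) ^ 2) ≤
      ∫⁻ t in Ioi 0, gaussianPDF 0 1 t * ENNReal.ofReal (deriv f t ^ 2) := by
  have hc : Continuous (deriv f) := hf.continuous_deriv le_rfl
  have hm : Measurable (deriv f) := hc.measurable
  set h : ℝ → ℝ≥0∞ := fun t => ENNReal.ofReal (deriv f t ^ 2) with hh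
  have hhm : Measurable h := by fun_prop
  let K : ℝ → ℝ → ℝ≥0∞ := fun x t =>
    {q : ℝ × ℝ | q.2 ≤ q.1}.indicator
      (fun q => gaussianPDF 0 1 q.1 * ENNReal.ofReal q.1 * h q.2) (x, t)
  have hKm : Measurable (Function.uncurry K) := by
    refine Measurable.indicator ?_ (measurableSet_le measurable_snd measurable_fst)
    exact (((measurable_gaussianPDF 0 1).comp measurable_fst).mul (by fun_prop)).mul
      (hhm.comp measurable_snd)
  have hstep : ∀ x ∈ Ioi (0 : ℝ), gaussianPDF 0 1 x * ENNReal.ofReal ((f x - f 0) ^ 2) ≤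
      ∫⁻ t in Ioi 0, K x t := by
    intro x hx
    have hx' : (0 : ℝ) < x := hx
    have h1 : ENNReal.ofReal ((f x - f 0) ^ 2) ≤ ENNReal.ofReal x * ∫⁻ t in Ioc 0 x, h t := by
      refine (ENNReal.ofReal_le_ofReal (sq_sub_le_mul_integral_deriv_sq hf hx')).trans ?_
      rw [ENNReal.ofReal_mul hx'.le, intervalIntegral.integral_of_le hx'.le,
        ofReal_integral_eq_lintegral_ofReal]
      · have := (show Continuous fun t => deriv f t ^ 2 by fun_prop).intervalIntegrable
          (μ := volume) 0 x
        exact (intervalIntegrable_iff_integrableOn_Ioc_of_le hx'.le).1 this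
      · exact Filter.Eventually.of_forall fun t => sq_nonneg _
    calc _ ≤ gaussianPDF 0 1 x * (ENNReal.ofReal x * ∫⁻ t in Ioc 0 x, h t) := by gcongr
      _ = ∫⁻ t in Ioc 0 x, gaussianPDF 0 1 x * ENNReal.ofReal x * h t := by
        rw [lintegral_const_mul _ hhm, mul_assoc]
      _ ≤ ∫⁻ t in Ioc 0 x, K x t := by
        refine setLIntegral_mono' measurableSet_Ioc fun t ht => ?_
        simp only [K]
        rw [indicator_of_mem (show (x, t) ∈ {q : ℝ × ℝ | q.2 ≤ q.1} from ht.2)]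
      _ ≤ _ := lintegral_mono_set Ioc_subset_Ioi_self
  calc _ ≤ ∫⁻ x in Ioi 0, ∫⁻ t in Ioi 0, K x t := setLIntegral_mono' measurableSet_Ioi hstep
    _ = ∫⁻ t in Ioi 0, ∫⁻ x in Ioi 0, K x t := lintegral_lintegral_swap hKm.aemeasurable
    _ ≤ _ := by
      refine setLIntegral_mono' measurableSet_Ioi fun t ht => ?_
      calc ∫⁻ x in Ioi 0, K x t ≤ ∫⁻ x, K x t := setLIntegral_le_lintegral _ _
        _ = ∫⁻ x, (Ici t).indicator (fun x => gaussianPDF 0 1 x * ENNReal.ofReal x * h t) x := rfl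
        _ = (∫⁻ x in Ici t, gaussianPDF 0 1 x * ENNReal.ofReal x) * h t := by
          rw [lintegral_indicator measurableSet_Ici, lintegral_mul_const]
          exact (measurable_gaussianPDF 0 1).mul (by fun_prop)
        _ = _ := by rw [lintegral_Ici_gaussianPDF_mul_id (le_of_lt ht)]

-- The density is even, so the negative half-line is the positive one for `x ↦ f (-x)`.
open Set in
theorem lintegral_sq_sub_le_stdGaussian {f : ℝ → ℝ} (hf : ContDiff ℝ 1 f) :
    ∫⁻ x, ENNReal.ofReal ((f x - f 0) ^ 2) ∂(gaussianReal 0 1) ≤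
      ∫⁻ x, ENNReal.ofReal (deriv f x ^ 2) ∂(gaussianReal 0 1) := by
  have hm : Measurable (deriv f) := (hf.continuous_deriv le_rfl).measurable
  have hfm : Measurable f := hf.continuous.measurable
  have hsplit : ∀ g : ℝ → ℝ≥0∞, Measurable g → ∫⁻ x, g x ∂(gaussianReal 0 1) =
      (∫⁻ x in Ioi 0, gaussianPDF 0 1 x * g x) + ∫⁻ x in Ioi 0, gaussianPDF 0 1 x * g (-x) := by
    intro g hg
    rw [gaussianReal_of_var_ne_zero _ one_ne_zero,
      lintegral_withDensity_eq_lintegral_mul _ (measurable_gaussianPDF 0 1) hg,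
      ← lintegral_add_compl _ measurableSet_Ioi (A := Ioi (0 : ℝ)), compl_Ioi]
    congr 1
    rw [setLIntegral_congr Iio_ae_eq_Iic.symm,
      ← (Measure.measurePreserving_neg (volume : Measure ℝ)).setLIntegral_comp_preimage
        measurableSet_Iio ((measurable_gaussianPDF 0 1).mul hg)]
    simp [gaussianPDF, gaussianPDFReal]
  rw [hsplit _ (by fun_prop), hsplit _ (by fun_prop)]
  refine add_le_add (setLIntegral_Ioi_gaussianPDF_mul_sq_sub_le hf) ?_
  have := setLIntegral_Ioi_gaussianPDF_mul_sq_sub_le (f := fun x => f (-x)) (hf.comp contDiff_neg)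
  simpa [deriv_comp_neg] using this

/-- Transport along `x ↦ s * x + a`; this also covers `s = 0`, where the law is a point mass at `a`.
-/
theorem lintegral_sq_sub_le_gaussianReal {f : ℝ → ℝ} (hf : ContDiff ℝ 1 f) (a : ℝ) (s : ℝ≥0) :
    ∫⁻ x, ENNReal.ofReal ((f x - f a) ^ 2) ∂(gaussianReal a (s ^ 2)) ≤
      ∫⁻ x, ENNReal.ofReal ((s * deriv f x) ^ 2) ∂(gaussianReal a (s ^ 2)) := by
  have hm : Measurable (deriv f) := (hf.continuous_deriv le_rfl).measurable
  have hfm : Measurable f := hf.continuous.measurable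
  have hmap : gaussianReal a (s ^ 2) = (gaussianReal 0 1).map (fun x => s * x + a) := by
    have : (fun x : ℝ => s * x + a) = (fun x => x + a) ∘ (fun x => s * x) := rfl
    rw [this, ← Measure.map_map (by fun_prop) (by fun_prop), gaussianReal_map_const_mul,
      gaussianReal_map_add_const]
    congr 1
    · simp
    · ext; simp
  rw [hmap, lintegral_map (by fun_prop) (by fun_prop), lintegral_map (by fun_prop) (by fun_prop)]
  have := lintegral_sq_sub_le_stdGaussian (f := fun x => f (s * x + a))
    (hf.comp ((contDiff_const.mul contDiff_id).add contDiff_const))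
  simp only [mul_zero, zero_add] at this
  refine this.trans_eq (lintegral_congr fun x => ?_)
  have hd : HasDerivAt (fun x => f (s * x + a)) (deriv f (s * x + a) * s) x := by
    have h1 : HasDerivAt (fun x : ℝ => s * x + a) s x := by
      simpa using ((hasDerivAt_id x).const_mul (s : ℝ)).add_const a
    exact ((hf.differentiable (by norm_num)).differentiableAt.hasDerivAt).comp x h1
  rw [hd.deriv, mul_comm]

/-! ### Variance in `[0,∞]` and its subadditivity over product measures. -/

theorem memLp_two_of_abs_le {α : Type*} [MeasurableSpace α] {μ : Measure α} [IsFiniteMeasure μ]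
    {X : α → ℝ} (hX : Measurable X) {C : ℝ} (hC : ∀ x, |X x| ≤ C) : MemLp X 2 μ :=
  MemLp.of_bound hX.aestronglyMeasurable C (Filter.Eventually.of_forall hC)

/-- Dropping either term on the right gives a useful inequality: the variance is the least mean
square deviation from a constant, and (for `c = 0`) Jensen's inequality for the square. -/
theorem lintegral_sq_sub_eq_evariance_add {α : Type*} [MeasurableSpace α] {μ : Measure α}
    [IsProbabilityMeasure μ] {X : α → ℝ} (hX : MemLp X 2 μ) (c : ℝ) :
    ∫⁻ x, ENNReal.ofReal ((X x - c) ^ 2) ∂μ =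
      eVar[X; μ] + ENNReal.ofReal ((∫ x, X x ∂μ - c) ^ 2) := by
  have hXi : Integrable X μ := hX.integrable (by norm_num)
  have h2 : ∀ b : ℝ, Integrable (fun x => (X x - b) ^ 2) μ := fun b =>
    (hX.sub (memLp_const b)).integrable_sq
  rw [evariance_eq_lintegral_ofReal, ← ofReal_integral_eq_lintegral_ofReal (h2 _)
    (Filter.Eventually.of_forall fun x => sq_nonneg _),
    ← ofReal_integral_eq_lintegral_ofReal (h2 _)
    (Filter.Eventually.of_forall fun x => sq_nonneg _),
    ← ENNReal.ofReal_add (integral_nonneg fun x => sq_nonneg _) (sq_nonneg _)]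
  congr 1
  set m := ∫ x, X x ∂μ with hm
  have : ∀ x, (X x - c) ^ 2 = (X x - m) ^ 2 + (2 * (m - c) * (X x - m) + (m - c) ^ 2) :=
    fun x => by ring
  simp_rw [this]
  have hsub : Integrable (fun x => X x - m) μ := hXi.sub (integrable_const m)
  have hlin : Integrable (fun x => 2 * (m - c) * (X x - m) + (m - c) ^ 2) μ :=
    (hsub.const_mul _).add (integrable_const _)
  rw [integral_add (h2 m) hlin,
    integral_add (hsub.const_mul _) (integrable_const _), integral_const_mul,
    integral_sub hXi (integrable_const m)]
  simp [← hm]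

theorem evariance_le_lintegral_sq_sub {α : Type*} [MeasurableSpace α] {μ : Measure α}
    [IsProbabilityMeasure μ] {X : α → ℝ} (hX : MemLp X 2 μ) (c : ℝ) :
    eVar[X; μ] ≤ ∫⁻ x, ENNReal.ofReal ((X x - c) ^ 2) ∂μ := by
  rw [lintegral_sq_sub_eq_evariance_add hX c]
  exact le_self_add

theorem ofReal_integral_sq_le {α : Type*} [MeasurableSpace α] {μ : Measure α}
    [IsProbabilityMeasure μ] {X : α → ℝ} (hX : MemLp X 2 μ) :
    ENNReal.ofReal ((∫ x, X x ∂μ) ^ 2) ≤ ∫⁻ x, ENNReal.ofReal (X x ^ 2) ∂μ := by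
  have := lintegral_sq_sub_eq_evariance_add hX 0
  simp only [sub_zero] at this
  rw [this]
  exact le_add_self

/-- Subadditivity of the variance over the two factors of a product of probability measures. -/
theorem evariance_prod_le {α β : Type*} [MeasurableSpace α] [MeasurableSpace β]
    {μ : Measure α} {ν : Measure β} [IsProbabilityMeasure μ] [IsProbabilityMeasure ν]
    {f : α × β → ℝ} (hf : Measurable f) {C : ℝ} (hC : ∀ z, |f z| ≤ C) :
    eVar[f; μ.prod ν] ≤
      ∫⁻ y, eVar[fun x => f (x, y); μ] ∂ν + ∫⁻ x, eVar[fun y => f (x, y); ν] ∂μ := by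
  have hsm := hf.stronglyMeasurable
  have hfi : Integrable f (μ.prod ν) := (memLp_two_of_abs_le hf hC).integrable (by norm_num)
  set c := ∫ z, f z ∂(μ.prod ν) with hc
  set h : β → ℝ := fun y => ∫ x, f (x, y) ∂μ with hh
  have hhm : Measurable h := hsm.integral_prod_left'.measurable
  have hhC : ∀ y, |h y| ≤ C := fun y => by
    have := norm_integral_le_of_norm_le_const (μ := μ) (f := fun x => f (x, y)) (C := C)
      (Filter.Eventually.of_forall fun x => hC _)
    simpa using this
  have hgm : Measurable fun x => ∫ y, f (x, y) ∂ν := hsm.integral_prod_right'.measurable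
  have hch : c = ∫ y, h y ∂ν := integral_prod_symm f hfi
  have hLx : ∀ x, MemLp (fun y => f (x, y)) 2 ν := fun x =>
    memLp_two_of_abs_le (by fun_prop) fun y => hC _
  have hLh : MemLp h 2 ν := memLp_two_of_abs_le hhm hhC
  -- As `c` is the mean of `h`, the left side is the squared mean of `f (x, ·) - h`. Jensen moves
  -- the square inside; integrated over `x`, the right side is then the variance in `x`, since `h y`
  -- is the mean of `f (·, y)`.
  have key : ∀ x, ENNReal.ofReal ((∫ y, f (x, y) ∂ν - c) ^ 2) ≤
      ∫⁻ y, ENNReal.ofReal ((f (x, y) - h y) ^ 2) ∂ν := by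
    intro x
    rw [hch, ← integral_sub ((hLx x).integrable (by norm_num)) (hLh.integrable (by norm_num))]
    exact ofReal_integral_sq_le ((hLx x).sub hLh)
  calc eVar[f; μ.prod ν]
      = ∫⁻ x, ∫⁻ y, ENNReal.ofReal ((f (x, y) - c) ^ 2) ∂ν ∂μ := by
        rw [evariance_eq_lintegral_ofReal, lintegral_prod _ (by fun_prop)]
    _ = ∫⁻ x, (eVar[fun y => f (x, y); ν] + ENNReal.ofReal ((∫ y, f (x, y) ∂ν - c) ^ 2)) ∂μ :=
        lintegral_congr fun x => lintegral_sq_sub_eq_evariance_add (hLx x) c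
    _ = ∫⁻ x, eVar[fun y => f (x, y); ν] ∂μ +
          ∫⁻ x, ENNReal.ofReal ((∫ y, f (x, y) ∂ν - c) ^ 2) ∂μ :=
        lintegral_add_right _ (by fun_prop)
    _ ≤ ∫⁻ x, eVar[fun y => f (x, y); ν] ∂μ +
          ∫⁻ x, ∫⁻ y, ENNReal.ofReal ((f (x, y) - h y) ^ 2) ∂ν ∂μ := by
        gcongr with x; exact key x
    _ = ∫⁻ x, eVar[fun y => f (x, y); ν] ∂μ + ∫⁻ y, eVar[fun x => f (x, y); μ] ∂ν := by
        rw [lintegral_lintegral_swap (by fun_prop)]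
        simp_rw [evariance_eq_lintegral_ofReal]
        rfl
    _ = _ := add_comm _ _

/-- The Efron–Stein inequality, with bounds on the coordinatewise variances. -/
theorem evariance_pi_le {Ω : Type*} [MeasurableSpace Ω] (n : ℕ) :
    ∀ (μ : Fin n → Measure Ω) [∀ i, IsProbabilityMeasure (μ i)] {f : (Fin n → Ω) → ℝ}
      (_ : Measurable f) {C : ℝ} (_ : ∀ x, |f x| ≤ C) {g : Fin n → (Fin n → Ω) → ℝ≥0∞}
      (_ : ∀ i, Measurable (g i))
      (_ : ∀ i x, eVar[fun t => f (Function.update x i t); μ i] ≤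
        ∫⁻ t, g i (Function.update x i t) ∂(μ i)),
      eVar[f; Measure.pi μ] ≤ ∑ i, ∫⁻ x, g i x ∂(Measure.pi μ) := by
  induction n with
  | zero =>
    intro μ _ f hf C hC g hg h
    have : f = fun _ => f Fin.elim0 := funext fun x => congrArg f (Subsingleton.elim _ _)
    rw [this]
    simp [evariance]
  | succ n ih =>
    intro μ _ f hf C hC g hg h
    have hmp := (measurePreserving_piFinSuccAbove μ 0).symm
    set e := (MeasurableEquiv.piFinSuccAbove (fun _ : Fin (n + 1) => Ω) 0).symm with he
    set ν := Measure.pi fun j : Fin n => μ (Fin.succAbove 0 j) with hν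
    have hcons : ∀ q : Ω × (Fin n → Ω), e q = Fin.cons q.1 q.2 := fun q => by
      simp [he, MeasurableEquiv.piFinSuccAbove, Fin.insertNthEquiv]
    have hup0 : ∀ (x : Fin n → Ω) (a t : Ω), Function.update (e (a, x)) 0 t = e (t, x) := by
      intro x a t
      rw [hcons, hcons]; exact Fin.update_cons_zero _ _ _
    have hups : ∀ (x : Fin n → Ω) (a t : Ω) (i : Fin n),
        Function.update (e (a, x)) i.succ t = e (a, Function.update x i t) := by
      intro x a t i
      rw [hcons, hcons]; exact (Fin.cons_update _ _ _ _).symm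
    have hlin : ∀ k : (Fin (n + 1) → Ω) → ℝ≥0∞, Measurable k →
        ∫⁻ x, k x ∂(Measure.pi μ) = ∫⁻ q, k (e q) ∂((μ 0).prod ν) := fun k hk =>
      (hmp.lintegral_comp hk).symm
    have hint : ∫ x, f x ∂(Measure.pi μ) = ∫ q, f (e q) ∂((μ 0).prod ν) :=
      (hmp.integral_comp' f).symm
    have hem : Measurable e := e.measurable
    have hvar : eVar[f; Measure.pi μ] = eVar[fun q => f (e q); (μ 0).prod ν] := by
      rw [evariance_eq_lintegral_ofReal, evariance_eq_lintegral_ofReal, hint,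
        hlin _ (by fun_prop)]
    have hΩ : Nonempty Ω := (μ 0).nonempty_of_neZero
    obtain ⟨a⟩ := hΩ
    rw [hvar, Fin.sum_univ_succ]
    refine (evariance_prod_le (hf.comp hem) fun q => hC _).trans (add_le_add ?_ ?_)
    · have hg0 : Measurable fun q => g 0 (e q) := (hg 0).comp hem
      rw [hlin _ (hg 0), lintegral_prod_symm _ hg0.aemeasurable]
      refine lintegral_mono fun x => ?_
      have := h 0 (e (a, x))
      simp only [hup0] at this
      exact this
    · calc _ ≤ ∫⁻ t, ∑ i : Fin n, ∫⁻ x, g i.succ (e (t, x)) ∂ν ∂(μ 0) := by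
            refine lintegral_mono fun t => ?_
            refine ih (fun j => μ (Fin.succAbove 0 j)) (f := fun x => f (e (t, x)))
              (hf.comp (hem.comp measurable_prodMk_left)) (C := C) (fun x => hC _)
              (g := fun i x => g i.succ (e (t, x)))
              (fun i => (hg _).comp (hem.comp measurable_prodMk_left)) fun i x => ?_
            simpa only [hups, Fin.zero_succAbove] using h i.succ (e (t, x))
        _ = ∑ i : Fin n, ∫⁻ t, ∫⁻ x, g i.succ (e (t, x)) ∂ν ∂(μ 0) :=
            lintegral_finsetSum _ fun i _ =>
              ((hg i.succ).comp hem).lintegral_prod_right'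
        _ = _ := by
            refine Finset.sum_congr rfl fun i _ => ?_
            have hgi : Measurable fun q => g i.succ (e q) := (hg i.succ).comp hem
            rw [hlin _ (hg i.succ), lintegral_prod _ hgi.aemeasurable]

/-! ### The Gaussian Poincaré inequality on `ℝᵈ`. -/

theorem gradient_apply_eq_fderiv_single {d : ℕ} (f : EuclideanSpace ℝ (Fin d) → ℝ)
    (x : EuclideanSpace ℝ (Fin d)) (i : Fin d) :
    gradient f x i = fderiv ℝ f x (EuclideanSpace.single i 1) := by
  have h : inner ℝ (gradient f x) (EuclideanSpace.single i (1 : ℝ)) =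
      fderiv ℝ f x (EuclideanSpace.single i 1) := InnerProductSpace.toDual_symm_apply
  rw [← h, EuclideanSpace.inner_single_right]
  simp

theorem continuous_gradient_of_contDiff {d : ℕ} {f : EuclideanSpace ℝ (Fin d) → ℝ}
    (hf : ContDiff ℝ 1 f) : Continuous (gradient f) :=
  (InnerProductSpace.toDual ℝ (EuclideanSpace ℝ (Fin d))).symm.continuous.comp
    (hf.continuous_fderiv one_ne_zero)

theorem continuous_gradient_apply_toLp {d : ℕ} {f : EuclideanSpace ℝ (Fin d) → ℝ}
    (hf : ContDiff ℝ 1 f) (i : Fin d) :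
    Continuous fun x : Fin d → ℝ => gradient f (WithLp.toLp 2 x) i :=
  (continuous_apply i).comp ((PiLp.continuous_ofLp 2 fun _ : Fin d => ℝ).comp
    ((continuous_gradient_of_contDiff hf).comp (PiLp.continuous_toLp 2 fun _ : Fin d => ℝ)))

theorem hasDerivAt_toLp_update {d : ℕ} (x : Fin d → ℝ) (i : Fin d) (t : ℝ) :
    HasDerivAt (fun s => (WithLp.toLp 2 (Function.update x i s) : EuclideanSpace ℝ (Fin d)))
      (EuclideanSpace.single i 1) t :=
  ((PiLp.continuousLinearEquiv 2 ℝ fun _ : Fin d => ℝ).symm.hasFDerivAt).comp_hasDerivAt t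
    (hasDerivAt_update x i t)

theorem contDiff_toLp_update {d : ℕ} (x : Fin d → ℝ) (i : Fin d) :
    ContDiff ℝ 1 fun s => (WithLp.toLp 2 (Function.update x i s) : EuclideanSpace ℝ (Fin d)) :=
  ((PiLp.continuousLinearEquiv 2 ℝ fun _ : Fin d => ℝ).symm.contDiff).comp
    (contDiff_update 1 x i)

theorem deriv_comp_toLp_update {d : ℕ} {f : EuclideanSpace ℝ (Fin d) → ℝ} (hf : ContDiff ℝ 1 f)
    (x : Fin d → ℝ) (i : Fin d) (t : ℝ) :
    deriv (fun s => f (WithLp.toLp 2 (Function.update x i s))) t =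
      gradient f (WithLp.toLp 2 (Function.update x i t)) i := by
  rw [gradient_apply_eq_fderiv_single]
  exact (((hf.differentiable one_ne_zero).differentiableAt.hasFDerivAt).comp_hasDerivAt t
    (hasDerivAt_toLp_update x i t)).deriv

theorem abs_min_sub_min_le (a b c : ℝ) : |min a c - min b c| ≤ |a - b| := by
  simpa using abs_min_sub_min_le_max a c b c

/-- The Gaussian Poincaré inequality for the truncations of a nonnegative function. -/
theorem evariance_min_le_pi_gaussianReal {d : ℕ} (μ : Fin d → ℝ) (σ : Fin d → ℝ≥0)
    {f : EuclideanSpace ℝ (Fin d) → ℝ} (hf : ContDiff ℝ 1 f) (hf0 : ∀ x, 0 ≤ f x) (n : ℕ) :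
    eVar[fun x => min (f (WithLp.toLp 2 x)) n;
        Measure.pi fun i => gaussianReal (μ i) (σ i ^ 2)] ≤
      ∫⁻ x, ENNReal.ofReal (‖(WithLp.toLp 2 fun i => (σ i : ℝ) * gradient f (WithLp.toLp 2 x) i :
        EuclideanSpace ℝ (Fin d))‖ ^ 2) ∂(Measure.pi fun i => gaussianReal (μ i) (σ i ^ 2)) := by
  have htoLp : Continuous fun x : Fin d → ℝ => (WithLp.toLp 2 x : EuclideanSpace ℝ (Fin d)) :=
    PiLp.continuous_toLp 2 _
  have hFm : Measurable fun x : Fin d → ℝ => f (WithLp.toLp 2 x) :=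
    (hf.continuous.comp htoLp).measurable
  have hgm : ∀ i : Fin d, Measurable fun x : Fin d → ℝ =>
      ENNReal.ofReal ((σ i * gradient f (WithLp.toLp 2 x) i) ^ 2) := fun i => by
    exact (((continuous_gradient_apply_toLp hf i).measurable.const_mul _).pow_const 2).ennreal_ofReal
  have hb : ∀ x : EuclideanSpace ℝ (Fin d), |min (f x) n| ≤ n := fun x => by
    rw [abs_of_nonneg (le_min (hf0 _) n.cast_nonneg)]
    exact min_le_right _ _
  have h1 : ∀ (i : Fin d) (x : Fin d → ℝ),
      eVar[fun t => min (f (WithLp.toLp 2 (Function.update x i t))) n;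
        gaussianReal (μ i) (σ i ^ 2)] ≤
      ∫⁻ t, ENNReal.ofReal ((σ i * gradient f (WithLp.toLp 2 (Function.update x i t)) i) ^ 2)
        ∂(gaussianReal (μ i) (σ i ^ 2)) := by
    intro i x
    have hu : ContDiff ℝ 1 fun s => f (WithLp.toLp 2 (Function.update x i s)) :=
      hf.comp (contDiff_toLp_update x i)
    have hL : MemLp (fun t => min (f (WithLp.toLp 2 (Function.update x i t))) n) 2
        (gaussianReal (μ i) (σ i ^ 2)) :=
      memLp_two_of_abs_le (hu.continuous.measurable.min measurable_const) fun t => hb _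
    have hp := lintegral_sq_sub_le_gaussianReal hu (μ i) (σ i)
    simp_rw [deriv_comp_toLp_update hf] at hp
    -- The truncation need not be differentiable, but it is 1-Lipschitz. Centring at its value at `μ
    -- i`, instead of at its mean, allows a pointwise comparison with the untruncated function.
    refine (evariance_le_lintegral_sq_sub hL
      (min (f (WithLp.toLp 2 (Function.update x i (μ i)))) n)).trans (le_trans ?_ hp)
    exact lintegral_mono fun t =>
      ENNReal.ofReal_le_ofReal (sq_le_sq.2 (abs_min_sub_min_le _ _ _))
  have h2 := evariance_pi_le d (fun i => gaussianReal (μ i) (σ i ^ 2))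
    (hFm.min measurable_const) (fun x => hb _) hgm h1
  refine h2.trans_eq ?_
  rw [← lintegral_finsetSum _ fun i _ => hgm i]
  refine lintegral_congr fun x => ?_
  rw [EuclideanSpace.real_norm_sq_eq, ENNReal.ofReal_sum_of_nonneg fun i _ => sq_nonneg _]

/-- The truncated bound is uniform in the level, so Fatou's lemma removes it. Integrability of `f`
gives convergence of the truncated means; square integrability is not assumed. -/
theorem evariance_le_pi_gaussianReal {d : ℕ} (μ : Fin d → ℝ) (σ : Fin d → ℝ≥0)
    {f : EuclideanSpace ℝ (Fin d) → ℝ} (hf : ContDiff ℝ 1 f) (hf0 : ∀ x, 0 ≤ f x)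
    (hfi : Integrable (fun x => f (WithLp.toLp 2 x))
      (Measure.pi fun i => gaussianReal (μ i) (σ i ^ 2))) :
    eVar[fun x => f (WithLp.toLp 2 x); Measure.pi fun i => gaussianReal (μ i) (σ i ^ 2)] ≤
      ∫⁻ x, ENNReal.ofReal (‖(WithLp.toLp 2 fun i => (σ i : ℝ) * gradient f (WithLp.toLp 2 x) i :
        EuclideanSpace ℝ (Fin d))‖ ^ 2) ∂(Measure.pi fun i => gaussianReal (μ i) (σ i ^ 2)) := by
  set γ := Measure.pi fun i => gaussianReal (μ i) (σ i ^ 2) with hγ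
  set F : (Fin d → ℝ) → ℝ := fun x => f (WithLp.toLp 2 x) with hF
  have hFm : Measurable F := (hf.continuous.comp (PiLp.continuous_toLp 2 _)).measurable
  have hmin : ∀ x, Filter.Tendsto (fun n : ℕ => min (F x) n) Filter.atTop (nhds (F x)) := by
    intro x
    refine tendsto_const_nhds.congr' ?_
    filter_upwards [Filter.eventually_ge_atTop ⌈F x⌉₊] with n hn
    exact (min_eq_left ((Nat.le_ceil _).trans (by exact_mod_cast hn))).symm
  have hL : Filter.Tendsto (fun n : ℕ => ∫ x, min (F x) n ∂γ) Filter.atTop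
      (nhds (∫ x, F x ∂γ)) := by
    refine tendsto_integral_of_dominated_convergence F
      (fun n => (hFm.min measurable_const).aestronglyMeasurable) hfi
      (fun n => Filter.Eventually.of_forall fun x => ?_)
      (Filter.Eventually.of_forall hmin)
    rw [Real.norm_of_nonneg (le_min (hf0 _) n.cast_nonneg)]
    exact min_le_left _ _
  have hlim : ∀ x, Filter.liminf (fun n : ℕ =>
      ENNReal.ofReal ((min (F x) n - ∫ z, min (F z) n ∂γ) ^ 2)) Filter.atTop =
      ENNReal.ofReal ((F x - ∫ z, F z ∂γ) ^ 2) := fun x =>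
    (ENNReal.tendsto_ofReal (((hmin x).sub hL).pow 2)).liminf_eq
  rw [evariance_eq_lintegral_ofReal]
  simp_rw [← hlim]
  refine (lintegral_liminf_le fun n => ?_).trans ?_
  · exact (((hFm.min measurable_const).sub_const _).pow_const 2).ennreal_ofReal
  · refine Filter.liminf_le_of_le (by isBoundedDefault) fun b hb => ?_
    obtain ⟨n, hn⟩ := hb.exists
    refine hn.trans ?_
    rw [← evariance_eq_lintegral_ofReal]
    exact evariance_min_le_pi_gaussianReal μ σ hf hf0 n

open PACBayes in
/-- The Gaussian Poincaré inequality. -/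
theorem evariance_classLaw_le {Y : Type*} {d : ℕ} (μ : Y → Fin d → ℝ) (σ : Y → Fin d → ℝ≥0)
    (y : Y) {f : Data d → ℝ} (hf : ContDiff ℝ 1 f) (hf0 : ∀ x, 0 ≤ f x)
    (hfi : Integrable f (classLaw μ σ y)) :
    eVar[f; classLaw μ σ y] ≤
      ∫⁻ x, ENNReal.ofReal (‖(WithLp.toLp 2 fun i => (σ y i : ℝ) * gradient f x i : Data d)‖ ^ 2)
        ∂(classLaw μ σ y) := by
  have hm : MeasurableEmbedding fun x : Fin d → ℝ => (WithLp.toLp 2 x : Data d) :=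
    (MeasurableEquiv.toLp 2 (Fin d → ℝ)).measurableEmbedding
  have hi := (hm.integrable_map_iff).1 hfi
  have := evariance_le_pi_gaussianReal (μ y) (σ y) hf hf0 hi
  rw [evariance_eq_lintegral_ofReal] at this ⊢
  rw [classLaw, hm.lintegral_map, hm.lintegral_map, hm.integral_map]
  exact this

/-! ### Exponential moments of nonnegative functions. -/

theorem exp_le_one_add_add_sq_mul_exp {v L : ℝ} (hL : 0 ≤ L) (hv : v ≤ L) :
    Real.exp v ≤ 1 + v + Real.exp L / 2 * v ^ 2 := by
  rcases le_total 0 v with h | h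
  -- Comparing the values at `0` and `v` and multiplying by `exp v` gives `exp v ≤ 1 + v + v ^ 2 / 2
  -- * exp v`.
  · have hmono : Monotone fun x : ℝ => (1 + x) * Real.exp (-x) + x ^ 2 / 2 := by
      have hd : ∀ x : ℝ, HasDerivAt (fun x : ℝ => (1 + x) * Real.exp (-x) + x ^ 2 / 2)
          (x * (1 - Real.exp (-x))) x := fun x => by
        have h1 := (((hasDerivAt_id x).const_add 1).mul (hasDerivAt_neg x).exp).add
          (((hasDerivAt_id x).pow 2).div_const 2)
        refine h1.congr_deriv ?_
        simp
        ring
      refine monotone_of_deriv_nonneg (fun x => (hd x).differentiableAt) fun x => ?_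
      rw [(hd x).deriv]
      rcases le_total 0 x with hx | hx
      · exact mul_nonneg hx (by simpa using hx)
      · exact mul_nonneg_of_nonpos_of_nonpos hx (by simpa using hx)
    have h0 : 1 ≤ (1 + v) * Real.exp (-v) + v ^ 2 / 2 := by simpa using hmono h
    have h1 := mul_le_mul_of_nonneg_right h0 (Real.exp_pos v).le
    have h2 : Real.exp (-v) * Real.exp v = 1 := by rw [← Real.exp_add]; simp
    have h3 : Real.exp v ≤ Real.exp L := Real.exp_le_exp.2 hv
    have h4 : v ^ 2 / 2 * Real.exp v ≤ v ^ 2 / 2 * Real.exp L := by gcongr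
    linear_combination h1 + h4 + (1 + v) * h2
  · have hanti : Antitone fun x : ℝ => 1 + x + x ^ 2 / 2 - Real.exp x := by
      have hd : ∀ x : ℝ, HasDerivAt (fun x : ℝ => 1 + x + x ^ 2 / 2 - Real.exp x)
          (1 + x - Real.exp x) x := fun x => by
        have h1 := (((hasDerivAt_id x).const_add 1).add
          (((hasDerivAt_id x).pow 2).div_const 2)).sub (Real.hasDerivAt_exp x)
        refine h1.congr_deriv ?_
        simp
      refine antitone_of_deriv_nonpos (fun x => (hd x).differentiableAt) fun x => ?_
      rw [(hd x).deriv]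
      linarith [Real.add_one_le_exp x]
    have h0 : 0 ≤ 1 + v + v ^ 2 / 2 - Real.exp v := by simpa using hanti h
    have h1 : 1 * (v ^ 2 / 2) ≤ Real.exp L * (v ^ 2 / 2) := by
      gcongr
      exact Real.one_le_exp hL
    linarith

/-- The mean of a nonnegative function is the derivative at zero of minus its Laplace transform. -/
theorem tendsto_one_sub_laplace_div {α : Type*} [MeasurableSpace α] {μ : Measure α}
    [IsProbabilityMeasure μ] {f : α → ℝ} (hf : Integrable f μ) (hf0 : ∀ x, 0 ≤ f x) :
    Filter.Tendsto (fun a : ℝ => (1 - ∫ x, Real.exp (-a * f x) ∂μ) / a) (nhdsWithin 0 (Set.Ioi 0))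
      (nhds (∫ x, f x ∂μ)) := by
  have hmeas : ∀ a : ℝ, AEStronglyMeasurable (fun x => Real.exp (-a * f x)) μ := fun a =>
    Real.continuous_exp.comp_aestronglyMeasurable (hf.aestronglyMeasurable.const_mul (-a))
  have hexp : ∀ a : ℝ, 0 < a → Integrable (fun x => Real.exp (-a * f x)) μ := fun a ha => by
    refine Integrable.of_bound (hmeas a) 1 (Filter.Eventually.of_forall fun x => ?_)
    rw [Real.norm_of_nonneg (Real.exp_pos _).le, Real.exp_le_one_iff]
    nlinarith [hf0 x]
  have hlim : Filter.Tendsto (fun a : ℝ => ∫ x, (1 - Real.exp (-a * f x)) / a ∂μ)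
      (nhdsWithin 0 (Set.Ioi 0)) (nhds (∫ x, f x ∂μ)) := by
    refine tendsto_integral_filter_of_dominated_convergence f ?_ ?_ hf ?_
    · exact Filter.Eventually.of_forall fun a =>
        ((aestronglyMeasurable_const.sub (hmeas a)).mul_const a⁻¹)
    -- The quotients are dominated by `f` itself, because `1 - exp (-u) ≤ u`.
    · filter_upwards [self_mem_nhdsWithin] with a ha
      refine Filter.Eventually.of_forall fun x => ?_
      have ha' : (0 : ℝ) < a := ha
      have h1 : Real.exp (-a * f x) ≤ 1 := by
        rw [Real.exp_le_one_iff]; nlinarith [hf0 x]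
      rw [Real.norm_of_nonneg (div_nonneg (by linarith) ha'.le), div_le_iff₀ ha']
      linarith [Real.add_one_le_exp (-a * f x)]
    · refine Filter.Eventually.of_forall fun x => ?_
      have hd : HasDerivAt (fun a : ℝ => -Real.exp (-a * f x)) (f x) 0 := by
        have := (((hasDerivAt_neg (0 : ℝ)).mul_const (f x)).exp).neg
        refine this.congr_deriv ?_
        simp
      have := (hasDerivAt_iff_tendsto_slope.1 hd).mono_left
        (nhdsWithin_mono 0 fun a (ha : 0 < a) => ha.ne')
      refine this.congr fun a => ?_
      simp only [slope_def_field, sub_zero, neg_zero, zero_mul, Real.exp_zero]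
      ring
  refine hlim.congr' ?_
  filter_upwards [self_mem_nhdsWithin] with a ha
  rw [integral_div, integral_sub (integrable_const _) (hexp a ha)]
  simp

/-- A sub-Gaussian type bound for the left tail of a nonnegative function. -/
theorem integrable_exp_and_integral_exp_le {α : Type*} [MeasurableSpace α] {μ : Measure α}
    [IsProbabilityMeasure μ] {f : α → ℝ} (hf : Integrable f μ) (hf0 : ∀ x, 0 ≤ f x)
    {a : ℝ} (ha0 : 0 ≤ a) (ha1 : a ≤ 1) {g : ℝ} (hg0 : 0 ≤ g)
    (hg : eVar[f; μ] ≤ ENNReal.ofReal g) :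
    Integrable (fun x => Real.exp (a * (∫ z, f z ∂μ - f x))) μ ∧
      ∫ x, Real.exp (a * (∫ z, f z ∂μ - f x)) ∂μ ≤
        Real.exp (a ^ 2 * Real.exp (∫ z, f z ∂μ) / 2 * g) := by
  set L := ∫ z, f z ∂μ with hL
  have hL0 : 0 ≤ L := integral_nonneg hf0
  have hlt : eVar[f; μ] < ∞ := hg.trans_lt ENNReal.ofReal_lt_top
  have h2 : MemLp f 2 μ := (evariance_lt_top_iff_memLp hf.aestronglyMeasurable).1 hlt
  have hvar : Var[f; μ] ≤ g := ENNReal.toReal_le_of_le_ofReal hg0 hg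
  have hsq : Integrable (fun x => (f x - L) ^ 2) μ := (h2.sub (memLp_const L)).integrable_sq
  have hvi : ∫ x, (f x - L) ^ 2 ∂μ = Var[f; μ] := (variance_eq_integral hf.aemeasurable).symm
  have hlin : Integrable (fun x => L - f x) μ := (integrable_const L).sub hf
  have hlin1 : Integrable (fun x => 1 + a * (L - f x)) μ :=
    (integrable_const 1).add (hlin.const_mul a)
  have hquad : Integrable (fun x => Real.exp L / 2 * a ^ 2 * (f x - L) ^ 2) μ := hsq.const_mul _
  have hpt : ∀ x, Real.exp (a * (L - f x)) ≤
      1 + a * (L - f x) + Real.exp L / 2 * a ^ 2 * (f x - L) ^ 2 := by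
    intro x
    -- Here `a ≤ 1` and `f ≥ 0` are essential: only deviations below the mean enlarge the
    -- exponential, and they are at most `L`.
    have hv : a * (L - f x) ≤ L := by nlinarith [hf0 x, mul_nonneg ha0 (hf0 x)]
    refine (exp_le_one_add_add_sq_mul_exp hL0 hv).trans_eq ?_
    ring
  have hei : Integrable (fun x => Real.exp (a * (L - f x))) μ := by
    refine (hlin1.add hquad).mono'
      (Real.continuous_exp.comp_aestronglyMeasurable (hlin.aestronglyMeasurable.const_mul a))
      (Filter.Eventually.of_forall fun x => ?_)
    rw [Real.norm_of_nonneg (Real.exp_pos _).le]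
    exact hpt x
  refine ⟨hei, (integral_mono hei (hlin1.add hquad) hpt).trans ?_⟩
  have hI : ∫ x, (1 + a * (L - f x) + Real.exp L / 2 * a ^ 2 * (f x - L) ^ 2) ∂μ =
      1 + Real.exp L / 2 * a ^ 2 * Var[f; μ] := by
    rw [integral_add hlin1 hquad, integral_const_mul, hvi,
      integral_add (integrable_const 1) (hlin.const_mul a), integral_const_mul,
      integral_sub (integrable_const L) hf]
    simp [← hL]
  refine (le_of_eq hI).trans ?_
  have h3 : Real.exp L / 2 * a ^ 2 * Var[f; μ] ≤ a ^ 2 * Real.exp L / 2 * g := by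
    have : Real.exp L / 2 * a ^ 2 * Var[f; μ] ≤ Real.exp L / 2 * a ^ 2 * g := by gcongr
    linarith
  linarith [Real.add_one_le_exp (a ^ 2 * Real.exp L / 2 * g)]

/-! ### The mixture law, balanced losses and the bound for a fixed parameter. -/

theorem measurableEmbedding_prodMk_const {α β : Type*} [MeasurableSpace α] [MeasurableSpace β]
    [MeasurableSingletonClass β] (y : β) : MeasurableEmbedding fun x : α => (x, y) :=
  MeasurableEmbedding.id.prodMk_right y

namespace PACBayes

instance isProbabilityMeasure_classLaw {Y : Type*} {d : ℕ} (μ : Y → Fin d → ℝ)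
    (σ : Y → Fin d → ℝ≥0) (y : Y) : IsProbabilityMeasure (classLaw μ σ y) :=
  Measure.isProbabilityMeasure_map (MeasurableEquiv.toLp 2 (Fin d → ℝ)).measurable.aemeasurable

section

variable {Y : Type*} [MeasurableSpace Y] [MeasurableSingletonClass Y] {d : ℕ}
  (π : PMF Y) (μ : Y → Fin d → ℝ) (σ : Y → Fin d → ℝ≥0)

theorem lintegral_dataLaw (g : Data d × Y → ℝ≥0∞) :
    ∫⁻ z, g z ∂(dataLaw π μ σ) = ∑' y, π y * ∫⁻ x, g (x, y) ∂(classLaw μ σ y) := by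
  rw [dataLaw, lintegral_sum_measure]
  refine tsum_congr fun y => ?_
  rw [lintegral_smul_measure, Measure.prod_dirac,
    (measurableEmbedding_prodMk_const y).lintegral_map]
  rfl

instance isProbabilityMeasure_dataLaw : IsProbabilityMeasure (dataLaw π μ σ) := ⟨by
  rw [← lintegral_one, lintegral_dataLaw]
  simp [π.tsum_coe]⟩

theorem integrable_classLaw_of_dataLaw {f : Data d × Y → ℝ} (hf : Integrable f (dataLaw π μ σ))
    {y : Y} (hy : π y ≠ 0) : Integrable (fun x => f (x, y)) (classLaw μ σ y) := by
  have h1 : Integrable f (π y • (classLaw μ σ y).prod (Measure.dirac y)) :=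
    hf.mono_measure (Measure.le_sum (fun y => π y • (classLaw μ σ y).prod (Measure.dirac y)) y)
  rw [integrable_smul_measure hy (π.apply_ne_top y), Measure.prod_dirac,
    (measurableEmbedding_prodMk_const y).integrable_map_iff] at h1
  exact h1

variable {W : Type*} {ℓ : W → Data d → Y → ℝ}

/-- The class means are derivatives at zero of the balanced Laplace transforms, so they coincide,
and the risk is their average. Labels of mass zero are excluded because `hrisk` gives no
integrability there. -/
theorem integral_classLaw_eq_risk (hnonneg : ∀ w x y, 0 ≤ ℓ w x y)
    (hrisk : ∀ w, Integrable (fun z : Data d × Y => ℓ w z.1 z.2) (dataLaw π μ σ))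
    {a : ℝ} (ha : 0 < a) (hbal : IsLabelBalanced μ σ ℓ a) (w : W) {y : Y} (hy : π y ≠ 0) :
    ∫ x, ℓ w x y ∂(classLaw μ σ y) = risk (dataLaw π μ σ) ℓ w := by
  have hint : ∀ y, π y ≠ 0 → Integrable (fun x => ℓ w x y) (classLaw μ σ y) := fun y hy =>
    integrable_classLaw_of_dataLaw π μ σ (hrisk w) hy
  have heq : ∀ y', π y' ≠ 0 →
      ∫ x, ℓ w x y' ∂(classLaw μ σ y') = ∫ x, ℓ w x y ∂(classLaw μ σ y) := by
    intro y' hy'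
    refine tendsto_nhds_unique (tendsto_one_sub_laplace_div (hint y' hy') fun x => hnonneg w x y')
      ((tendsto_one_sub_laplace_div (hint y hy) fun x => hnonneg w x y).congr' ?_)
    filter_upwards [Ioc_mem_nhdsGT ha] with b hb
    obtain ⟨c, hc⟩ := hbal w b hb
    rw [hc y, hc y']
  have hL0 : 0 ≤ ∫ x, ℓ w x y ∂(classLaw μ σ y) := integral_nonneg fun x => hnonneg w x y
  rw [risk, integral_eq_lintegral_of_nonneg_ae (f := fun z : Data d × Y => ℓ w z.1 z.2)
    (Filter.Eventually.of_forall fun z => hnonneg w z.1 z.2) (hrisk w).aestronglyMeasurable,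
    lintegral_dataLaw]
  have hterm : ∀ y', π y' * ∫⁻ x, ENNReal.ofReal (ℓ w x y') ∂(classLaw μ σ y') =
      π y' * ENNReal.ofReal (∫ x, ℓ w x y ∂(classLaw μ σ y)) := by
    intro y'
    by_cases hy' : π y' = 0
    · simp [hy']
    · rw [← heq y' hy', ofReal_integral_eq_lintegral_ofReal (hint y' hy')
        (Filter.Eventually.of_forall fun x => hnonneg w x y')]
  simp_rw [hterm]
  rw [ENNReal.tsum_mul_right, π.tsum_coe, one_mul, ENNReal.toReal_ofReal hL0]

/-- The Poincaré inequality for a balanced loss. -/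
theorem evariance_dataLaw_le_weightedGradientEnergy (hnonneg : ∀ w x y, 0 ≤ ℓ w x y)
    (hsmooth : ∀ w y, ContDiff ℝ 1 fun x => ℓ w x y)
    (hrisk : ∀ w, Integrable (fun z : Data d × Y => ℓ w z.1 z.2) (dataLaw π μ σ))
    {a : ℝ} (ha : 0 < a) (hbal : IsLabelBalanced μ σ ℓ a) (w : W) :
    eVar[fun z : Data d × Y => ℓ w z.1 z.2; dataLaw π μ σ] ≤
      weightedGradientEnergy (dataLaw π μ σ) σ ℓ w := by
  rw [evariance_eq_lintegral_ofReal, weightedGradientEnergy, lintegral_dataLaw, lintegral_dataLaw]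
  refine ENNReal.tsum_le_tsum fun y => ?_
  by_cases hy : π y = 0
  · simp [hy]
  have h := evariance_classLaw_le μ σ y (hsmooth w y) (fun x => hnonneg w x y)
    (integrable_classLaw_of_dataLaw π μ σ (hrisk w) hy)
  -- The class mean equals the global risk, so both variances have the same centre and the
  -- comparison is label by label.
  rw [evariance_eq_lintegral_ofReal,
    integral_classLaw_eq_risk π μ σ hnonneg hrisk ha hbal w hy] at h
  exact mul_le_mul_right h _

theorem lintegral_exp_risk_sub_empiricalRisk_le (hnonneg : ∀ w x y, 0 ≤ ℓ w x y)
    (hsmooth : ∀ w y, ContDiff ℝ 1 fun x => ℓ w x y)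
    (hrisk : ∀ w, Integrable (fun z : Data d × Y => ℓ w z.1 z.2) (dataLaw π μ σ))
    {m : ℕ} {lam : ℝ} (hlam : 0 < lam) (hlam_le : lam ≤ m)
    (hbal : IsLabelBalanced μ σ ℓ (lam / m)) (w : W) :
    ∫⁻ S, ENNReal.ofReal (Real.exp
        (lam * (risk (dataLaw π μ σ) ℓ w - empiricalRisk ℓ S w)))
        ∂(Measure.pi fun _ : Fin m => dataLaw π μ σ) ≤
      EReal.exp ((ENNReal.ofReal
        (lam ^ 2 * Real.exp (risk (dataLaw π μ σ) ℓ w) / (2 * m)) *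
          weightedGradientEnergy (dataLaw π μ σ) σ ℓ w : ℝ≥0∞) : EReal) := by
  have hm : (0 : ℝ) < m := hlam.trans_le hlam_le
  have hc : 0 < lam ^ 2 * Real.exp (risk (dataLaw π μ σ) ℓ w) / (2 * m) := by positivity
  have ha : 0 < lam / m := div_pos hlam hm
  have hP := evariance_dataLaw_le_weightedGradientEnergy π μ σ hnonneg hsmooth hrisk ha hbal w
  -- If the energy is infinite, the positive coefficient makes the right side `⊤`.
  rcases eq_or_ne (weightedGradientEnergy (dataLaw π μ σ) σ ℓ w) ∞ with hG | hG
  · rw [hG, ENNReal.mul_top (ENNReal.ofReal_pos.2 hc).ne']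
    simp
  obtain ⟨hei, hle⟩ := integrable_exp_and_integral_exp_le (hrisk w)
    (fun z => hnonneg w z.1 z.2) ha.le ((div_le_one hm).2 hlam_le)
    (g := (weightedGradientEnergy (dataLaw π μ σ) σ ℓ w).toReal) ENNReal.toReal_nonneg
    (by rwa [ENNReal.ofReal_toReal hG])
  rw [← ENNReal.ofReal_toReal hG]
  set g := (weightedGradientEnergy (dataLaw π μ σ) σ ℓ w).toReal with hg
  have hg0 : 0 ≤ g := ENNReal.toReal_nonneg
  change Integrable (fun z : Data d × Y =>
    Real.exp (lam / m * (risk (dataLaw π μ σ) ℓ w - ℓ w z.1 z.2))) _ at hei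
  change ∫ z : Data d × Y, Real.exp (lam / m * (risk (dataLaw π μ σ) ℓ w - ℓ w z.1 z.2))
    ∂(dataLaw π μ σ) ≤ Real.exp ((lam / m) ^ 2 * Real.exp (risk (dataLaw π μ σ) ℓ w) / 2 * g) at hle
  set L := risk (dataLaw π μ σ) ℓ w with hL
  have hprod : ∀ S : Fin m → Data d × Y, Real.exp (lam * (L - empiricalRisk ℓ S w)) =
      ∏ i, Real.exp (lam / m * (L - ℓ w (S i).1 (S i).2)) := by
    intro S
    rw [← Real.exp_sum, ← Finset.mul_sum, Finset.sum_sub_distrib, empiricalRisk]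
    congr 1
    simp only [Finset.sum_const, Finset.card_univ, Fintype.card_fin, nsmul_eq_mul]
    field_simp
  simp_rw [hprod]
  rw [← ofReal_integral_eq_lintegral_ofReal (Integrable.fintype_prod fun _ => hei)
    (Filter.Eventually.of_forall fun S => Finset.prod_nonneg fun i _ => (Real.exp_pos _).le),
    integral_fintype_prod_eq_prod (fun (_ : Fin m) (z : Data d × Y) => Real.exp (lam / m * (L - ℓ w z.1 z.2))),
    ← ENNReal.ofReal_mul hc.le, EReal.coe_ennreal_ofReal,
    max_eq_left (mul_nonneg hc.le hg0), EReal.exp_coe]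
  refine ENNReal.ofReal_le_ofReal ?_
  rw [Finset.prod_const, Finset.card_univ, Fintype.card_fin]
  refine (pow_le_pow_left₀ (integral_nonneg fun z => (Real.exp_pos _).le) hle m).trans_eq ?_
  rw [← Real.exp_nat_mul]
  congr 1
  field_simp

end

theorem weightedGradientEnergy_le {W Y : Type*} [MeasurableSpace Y] {d : ℕ}
    {σ : Y → Fin d → ℝ≥0} {ℓ : W → Data d → Y → ℝ} (D : Measure (Data d × Y)) {s : ℝ≥0} (hs : ∀ y i, σ y i ≤ s)
    (w : W) :
    weightedGradientEnergy D σ ℓ w ≤ ENNReal.ofReal (s ^ 2) * gradientEnergy D ℓ w := by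
  rw [weightedGradientEnergy, gradientEnergy, ← lintegral_const_mul' _ _ ENNReal.ofReal_ne_top]
  refine lintegral_mono fun z => ?_
  rw [← ENNReal.ofReal_mul (by positivity)]
  refine ENNReal.ofReal_le_ofReal ?_
  rw [EuclideanSpace.real_norm_sq_eq, EuclideanSpace.real_norm_sq_eq, Finset.mul_sum]
  refine Finset.sum_le_sum fun i _ => ?_
  simp only [mul_pow]
  gcongr
  exact hs _ _

end PACBayes

/-! ### Averaging over the parameter. -/

theorem mainTheorem3
    {W : Type*} [MeasurableSpace W]
    {Y : Type*} [Countable Y] [MeasurableSpace Y] [MeasurableSingletonClass Y]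
    (d m : ℕ)
    (π : PMF Y) (μ : Y → Fin d → ℝ) (σ : Y → Fin d → ℝ≥0)
    (p : Measure W) [IsProbabilityMeasure p]
    (ℓ : W → PACBayes.Data d → Y → ℝ)
    (hmeas : ∀ y, Measurable fun q : W × PACBayes.Data d => ℓ q.1 q.2 y)
    (hnonneg : ∀ w x y, 0 ≤ ℓ w x y)
    (hsmooth : ∀ w y, ContDiff ℝ 1 fun x => ℓ w x y)
    (hrisk : ∀ w, Integrable (fun z : PACBayes.Data d × Y => ℓ w z.1 z.2)
      (PACBayes.dataLaw π μ σ))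
    (lam : ℝ) (hlam : 0 < lam) (hlam_le : lam ≤ m)
    (hbal : PACBayes.IsLabelBalanced μ σ ℓ (lam / m)) :
    PACBayes.complexityTerm (PACBayes.dataLaw π μ σ) ℓ m lam p ≤
        ENNReal.log (∫⁻ w, EReal.exp
          ((ENNReal.ofReal
              (lam ^ 2 * Real.exp (PACBayes.risk (PACBayes.dataLaw π μ σ) ℓ w) / (2 * m)) *
            PACBayes.weightedGradientEnergy (PACBayes.dataLaw π μ σ) σ ℓ w : ℝ≥0∞) : EReal) ∂p) ∧
      ∀ s : ℝ≥0, (∀ y i, σ y i ≤ s) →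
        PACBayes.complexityTerm (PACBayes.dataLaw π μ σ) ℓ m lam p ≤
          ENNReal.log (∫⁻ w, EReal.exp
            ((ENNReal.ofReal
                (lam ^ 2 * Real.exp (PACBayes.risk (PACBayes.dataLaw π μ σ) ℓ w) * s ^ 2 /
                  (2 * m)) *
              PACBayes.gradientEnergy (PACBayes.dataLaw π μ σ) ℓ w : ℝ≥0∞) : EReal) ∂p) := by
  have h1 : PACBayes.complexityTerm (PACBayes.dataLaw π μ σ) ℓ m lam p ≤
      ENNReal.log (∫⁻ w, EReal.exp
        ((ENNReal.ofReal
            (lam ^ 2 * Real.exp (PACBayes.risk (PACBayes.dataLaw π μ σ) ℓ w) / (2 * m)) *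
          PACBayes.weightedGradientEnergy (PACBayes.dataLaw π μ σ) σ ℓ w : ℝ≥0∞) : EReal) ∂p) :=
    -- An upper bound needs only one direction of Tonelli, which holds for arbitrary integrands.
    ENNReal.log_monotone <| (lintegral_prod_le _).trans <| lintegral_mono fun w =>
      PACBayes.lintegral_exp_risk_sub_empiricalRisk_le π μ σ hnonneg hsmooth hrisk hlam hlam_le
        hbal w
  refine ⟨h1, fun s hs => h1.trans (ENNReal.log_monotone (lintegral_mono fun w => ?_))⟩
  refine EReal.exp_monotone (EReal.coe_ennreal_le_coe_ennreal_iff.2 ?_)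
  refine (mul_le_mul_right (PACBayes.weightedGradientEnergy_le _ hs w) _).trans_eq ?_
  rw [← mul_assoc, ← ENNReal.ofReal_mul (by positivity)]
  congr 2
  ring
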